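/- Let $\mathcal{O}$ be a discrete valuation ring in which $2$ is invertible, and let $\pi$ be a uniformizer of $\mathcal{O}$ (for instance $\mathcal{O}=\mathcal{O}_{\breve F}$, where $\breve F$ is the completion of the maximal unramified extension of a finite extension $F$ of $\mathbb{Q}_p$, $p\neq 2$). Let $d=2n$ and $l=2r$ be even integers with $d\ge 5$, $l>1$ and $d-l>1$. Let $S=\mathcal{O}[(x_{i,j})_{1\le i,j\le d}]$, let $X=(x_{i,j})$ be the generic $d\times d$ matrix, and write it in blocks $$X=\begin{pmatrix}E_1&O_1&E_2\\ B_1&A&B_2\\ E_3&O_2&E_4\end{pmatrix}$$ with row and column blocks of sizes $n-r,\ l,\ n-r$. Let $J_m$ be the unit antidiagonal $m\times m$ matrix and put $$S_0=\begin{pmatrix}0&0&J_{n-r}\\0&0&0\\J_{n-r}&0&0\end{pmatrix},\qquad S_1=\begin{pmatrix}0&0&0\\0&J_l&0\\0&0&0\end{pmatrix}.$$ Let $I^{\rm naive}\subset S$ be the ideal generated by the entries of $X^2$, the $2\times 2$ minors of $X$, and the entries of $X^tS_0X-2\pi(S_0X+\pi S_1X)$ and of $X^tS_1X+2(S_0X+\pi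 S_1X)$. Let $I^{\rm add}\subset S$ be the ideal generated by $\mathrm{Tr}(X)$, $\mathrm{Tr}(A)+2\pi$, and the entries of $AJ_l-J_lA^t$ and of $B_2J_{n-r}B_1^t-AJ_l$. Put $I=I^{\rm naive}+I^{\rm add}$ and $U_{d,l}=\mathrm{Spec}(S/I)$. Then: 1. $U_{d,l}$ is flat over $\mathcal{O}$; 2. $\pi$ is a nonzerodivisor in $S/I$; 3. $I$ cuts out the flat closure of the naive chart $\mathrm{Spec}(S/I^{\rm naive})$ away from the zero section $X=0$: $I$ is the ideal of the scheme-theoretic closure in $\mathrm{Spec}(S)$ of the open subscheme of $\mathrm{Spec}(S/I^{\rm naive})$ on which $\pi$ is invertible and $X\neq 0$, that is, $$I=\bigcap_{i,j}\ker\Big(S\to (S/I^{\rm naive})\big[\tfrac{1}{\pi x_{i,j}}\big]\Big).$$ -/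

import Mathlib

namespace OrthogonalChart

/-- Row/column index set of a `d × d` matrix, `d = l + 2m`, cut into consecutive blocks of
sizes `m`, `l`, `m`. -/
abbrev Idx (m l : ℕ) : Type := Fin m ⊕ (Fin l ⊕ Fin m)

/-- Positions `1, …, m`. -/
abbrev fstIdx (m l : ℕ) : Fin m → Idx m l := Sum.inl

/-- Positions `m + 1, …, m + l`. -/
abbrev midIdx (m l : ℕ) : Fin l → Idx m l := fun i => Sum.inr (Sum.inl i)

/-- Positions `m + l + 1, …, d`. -/
abbrev lstIdx (m l : ℕ) : Fin m → Idx m l := fun i => Sum.inr (Sum.inr i)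

section Matrices

variable (R : Type*) [CommRing R]

/-- The unit antidiagonal matrix `J_k`. -/
def antidiag (k : ℕ) : Matrix (Fin k) (Fin k) R :=
  Matrix.of fun i j => if j = i.rev then 1 else 0

/-- `S₀`: antidiagonal, with ones in the two outer blocks and zeros in the middle one. -/
def S₀ (m l : ℕ) : Matrix (Idx m l) (Idx m l) R :=
  Matrix.of fun i j =>
    match i, j with
    | Sum.inl a, Sum.inr (Sum.inr b) => antidiag R m a b
    | Sum.inr (Sum.inr a), Sum.inl b => antidiag R m a b
    | _, _ => 0

/-- `S₁`: antidiagonal, with zeros in the two outer blocks and ones in the middle one. -/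
def S₁ (m l : ℕ) : Matrix (Idx m l) (Idx m l) R :=
  Matrix.of fun i j =>
    match i, j with
    | Sum.inr (Sum.inl a), Sum.inr (Sum.inl b) => antidiag R l a b
    | _, _ => 0

variable {R}

/-- The set of entries of a matrix. -/
def entries {ι κ : Type*} (M : Matrix ι κ R) : Set R :=
  Set.range fun p : ι × κ => M p.1 p.2

/-- The set of `2 × 2` minors of a matrix (`∧² M`). -/
def minors₂ {ι κ : Type*} (M : Matrix ι κ R) : Set R :=
  Set.range fun p : (ι × ι) × (κ × κ) =>
    M p.1.1 p.2.1 * M p.1.2 p.2.2 - M p.1.1 p.2.2 * M p.1.2 p.2.1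

/-- The ideal of the scheme-theoretic closure in `Spec R` of the open subscheme `g ≠ 0` of
`Spec (R ⧸ J)`: the kernel of `R → (R ⧸ J)[1/g]`. -/
def closureIdeal (J : Ideal R) (g : R) : Ideal R :=
  RingHom.ker
    ((algebraMap (R ⧸ J) (Localization.Away (Ideal.Quotient.mk J g))).comp (Ideal.Quotient.mk J))

end Matrices

section Chart

variable (𝒪 : Type*) [CommRing 𝒪] (m l : ℕ)

/-- `S = 𝒪[(x_{i,j})_{1 ≤ i, j ≤ d}]`. -/
abbrev PolyRing : Type _ := MvPolynomial (Idx m l × Idx m l) 𝒪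

/-- The generic matrix `X = (x_{i,j})`. -/
noncomputable def genericX : Matrix (Idx m l) (Idx m l) (PolyRing 𝒪 m l) :=
  Matrix.of fun i j => MvPolynomial.X (i, j)

/-- The middle block `A` of `X`. -/
noncomputable def blockA : Matrix (Fin l) (Fin l) (PolyRing 𝒪 m l) :=
  (genericX 𝒪 m l).submatrix (midIdx m l) (midIdx m l)

/-- The block `B₁` of `X` (middle rows, first columns). -/
noncomputable def blockB₁ : Matrix (Fin l) (Fin m) (PolyRing 𝒪 m l) :=
  (genericX 𝒪 m l).submatrix (midIdx m l) (fstIdx m l)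

/-- The block `B₂` of `X` (middle rows, last columns). -/
noncomputable def blockB₂ : Matrix (Fin l) (Fin m) (PolyRing 𝒪 m l) :=
  (genericX 𝒪 m l).submatrix (midIdx m l) (lstIdx m l)

variable {𝒪} (π : 𝒪)

open scoped Matrix in
/-- `I^naive`, generated by the entries of `X²`, the `2 × 2` minors of `X`, and the entries of
`Xᵗ S₀ X - 2π (S₀ X + π S₁ X)` and `Xᵗ S₁ X + 2 (S₀ X + π S₁ X)`. -/
noncomputable def naiveIdeal : Ideal (PolyRing 𝒪 m l) :=
  let X := genericX 𝒪 m l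
  let T₀ := S₀ (PolyRing 𝒪 m l) m l
  let T₁ := S₁ (PolyRing 𝒪 m l) m l
  let ϖ : PolyRing 𝒪 m l := MvPolynomial.C π
  Ideal.span
    (entries (X * X) ∪ minors₂ X ∪
      entries (Xᵀ * T₀ * X - (2 * ϖ) • (T₀ * X + ϖ • (T₁ * X))) ∪
      entries (Xᵀ * T₁ * X + (2 : PolyRing 𝒪 m l) • (T₀ * X + ϖ • (T₁ * X))))

open scoped Matrix in
/-- `I^add`, generated by `Tr X`, `Tr A + 2π` and the entries of `A J_l - J_l Aᵗ` and
`B₂ J_m B₁ᵗ - A J_l`. -/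
noncomputable def addIdeal : Ideal (PolyRing 𝒪 m l) :=
  let A := blockA 𝒪 m l
  let B₁ := blockB₁ 𝒪 m l
  let B₂ := blockB₂ 𝒪 m l
  let Jl := antidiag (PolyRing 𝒪 m l) l
  let Jm := antidiag (PolyRing 𝒪 m l) m
  Ideal.span
    ({(genericX 𝒪 m l).trace} ∪ {A.trace + 2 * MvPolynomial.C π} ∪
      entries (A * Jl - Jl * Aᵀ) ∪ entries (B₂ * Jm * B₁ᵀ - A * Jl))

/-- `I = I^naive + I^add`. -/
noncomputable def chartIdeal : Ideal (PolyRing 𝒪 m l) :=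
  naiveIdeal m l π + addIdeal m l π

/-- The coordinate ring `S ⧸ I`. -/
abbrev ChartRing : Type _ := PolyRing 𝒪 m l ⧸ chartIdeal m l π

/-- The affine chart `U = Spec (S ⧸ I)`. -/
noncomputable def chart : AlgebraicGeometry.Scheme :=
  AlgebraicGeometry.Spec (CommRingCat.of (ChartRing m l π))

/-- The structure morphism `U ⟶ Spec 𝒪`. -/
noncomputable def chartStructure :
    chart m l π ⟶ AlgebraicGeometry.Spec (CommRingCat.of 𝒪) :=
  AlgebraicGeometry.Spec.map (CommRingCat.ofHom (algebraMap 𝒪 (ChartRing m l π)))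

end Chart

end OrthogonalChart

/-! Write `P` for the polynomial ring in `u`, `v₁`, `v₂`, and put `s = uᵗJu`, `t = v₂ᵗJv₁`, `q = st
+ 2π`. Solving the equations by a rank one matrix `z wᵗ` gives a homomorphism `φ : S → P`
(`rankOneHom`), and the heart of the proof is that `I` equals `φ⁻¹(q)`. One inclusion is a
computation (`rankOne_naiveRel`, `rankOne_addRel`). For the other
(`mem_chartIdeal_of_rankOneHom_mem`), the `2 × 2` minors make pairing row variables with column
variables well defined, which yields a linear map `σ : P → S/I` with `σ(φ(e) g) = e σ(g)` and `σ(1)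
= 1`. Since `q = φ(Tr A + 2π)`, an equality `φ(f) = g q` gives `f = σ(φ(f)) = (Tr A + 2π) σ(g) = 0`
in `S/I`. Hence `S/I` embeds in `P/(q)`. As `π` is prime in `P` and does not divide `q`, it is
regular on `S/I`, and flatness over a discrete valuation ring follows. For the closure, the naive
equations imply the additional ones wherever `π` and some entry of `X` are invertible
(`NaiveRel.addRel`). Conversely, `Tr A = -2π` prevents a regular `π` from leaving room for sections
supported on `X = 0`. -/

namespace OrthogonalChart

open scoped Matrix

/-! ### The Segre relations and a linear map out of the polynomial ring -/

section Segre

variable {α β R : Type*} [CommRing R]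

/-- Adjacent transpositions generate all permutations, and one transposition is exactly one
vanishing `2 × 2` minor. -/
theorem prod_zipWith_perm_right {Y : α → β → R}
    (hY : ∀ a a' b b', Y a b * Y a' b' = Y a b' * Y a' b) {t t' : List β} (h : t.Perm t') :
    ∀ s : List α, s.length = t.length →
      (List.zipWith Y s t).prod = (List.zipWith Y s t').prod := by
  induction h with
  | nil => intro s _; rfl
  | cons b _ ih =>
    rintro (_ | ⟨a, s⟩) hs
    · rfl
    · simp only [List.zipWith_cons_cons, List.prod_cons]
      rw [ih s (by simpa using hs)]
  | swap b b' t =>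
    rintro (_ | ⟨a, _ | ⟨a', s⟩⟩) hs
    · rfl
    · simp at hs
    · simp only [List.zipWith_cons_cons, List.prod_cons, ← mul_assoc]
      rw [hY]
  | trans h₁ _ ih₁ ih₂ =>
    intro s hs
    rw [ih₁ s hs, ih₂ s (hs.trans h₁.length_eq)]

theorem prod_zipWith_perm {Y : α → β → R}
    (hY : ∀ a a' b b', Y a b * Y a' b' = Y a b' * Y a' b) {s s' : List α} {t t' : List β}
    (hs : s.Perm s') (ht : t.Perm t') (h : s.length = t.length) :
    (List.zipWith Y s t).prod = (List.zipWith Y s' t').prod := by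
  rw [prod_zipWith_perm_right hY ht s h, List.zipWith_comm, List.zipWith_comm (f := Y) (as := s')]
  exact prod_zipWith_perm_right (fun b b' a a' => by rw [mul_comm, hY, mul_comm]) hs t'
    (by rw [← ht.length_eq, h])

open Classical in
/-- The product of the entries of `Y` along a pairing of the row indices `s` with the column
indices `t`, and `0` if there is no such pairing. For a matrix all of whose `2 × 2` minors vanish
it does not depend on the pairing. -/
noncomputable def pairingProd (Y : α → β → R) (s : Multiset α) (t : Multiset β) : R :=
  if s.card = t.card then (List.zipWith Y s.toList t.toList).prod else 0

theorem pairingProd_zero (Y : α → β → R) : pairingProd Y 0 0 = 1 := by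
  simp [pairingProd]

/-- Because the pairing is immaterial, one may choose one that matches `a` with `b`. With unequal
cardinalities both sides take the default value `0`. -/
theorem pairingProd_cons {Y : α → β → R}
    (hY : ∀ a a' b b', Y a b * Y a' b' = Y a b' * Y a' b) (a : α) (b : β)
    (s : Multiset α) (t : Multiset β) :
    pairingProd Y (a ::ₘ s) (b ::ₘ t) = Y a b * pairingProd Y s t := by
  unfold pairingProd
  by_cases h : s.card = t.card
  · rw [if_pos (by simp [h]), if_pos h, ← List.prod_cons, ← List.zipWith_cons_cons]
    refine prod_zipWith_perm hY ?_ ?_ (by simp [h]) <;>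
    · rw [← Multiset.coe_eq_coe]
      simp [← Multiset.cons_coe]
  · rw [if_neg (by simpa using h), if_neg h, mul_zero]

variable (𝒪 : Type*) [CommRing 𝒪] [Algebra 𝒪 R]

/-- The linear map sending a monomial in row and column variables to the product of the entries
of `Y` along a pairing of its row variables with its column variables. -/
noncomputable def segreRetraction (Y : α → β → R) : MvPolynomial (α ⊕ β) 𝒪 →ₗ[𝒪] R :=
  (MvPolynomial.basisMonomials (α ⊕ β) 𝒪).constr 𝒪 fun c =>
    pairingProd Y ((Finsupp.toMultiset c).filterMap Sum.getLeft?)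
      ((Finsupp.toMultiset c).filterMap Sum.getRight?)

theorem segreRetraction_monomial (Y : α → β → R) (c : α ⊕ β →₀ ℕ) :
    segreRetraction 𝒪 Y (MvPolynomial.monomial c 1) =
      pairingProd Y ((Finsupp.toMultiset c).filterMap Sum.getLeft?)
        ((Finsupp.toMultiset c).filterMap Sum.getRight?) := by
  have := (MvPolynomial.basisMonomials (α ⊕ β) 𝒪).constr_basis 𝒪 (fun c =>
    pairingProd Y ((Finsupp.toMultiset c).filterMap Sum.getLeft?)
      ((Finsupp.toMultiset c).filterMap Sum.getRight?)) c
  simpa [segreRetraction] using this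

theorem segreRetraction_one (Y : α → β → R) : segreRetraction 𝒪 Y 1 = 1 := by
  rw [← MvPolynomial.C_1, ← MvPolynomial.monomial_zero', segreRetraction_monomial]
  simp [pairingProd_zero]

/-- It suffices to check monomials, where this is `pairingProd_cons`. The map is not multiplicative
in general; this weaker linearity is what replaces it. -/
theorem segreRetraction_mul {Y : α → β → R}
    (hY : ∀ a a' b b', Y a b * Y a' b' = Y a b' * Y a' b) (a : α) (b : β)
    (g : MvPolynomial (α ⊕ β) 𝒪) :
    segreRetraction 𝒪 Y (MvPolynomial.X (Sum.inl a) * MvPolynomial.X (Sum.inr b) * g) =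
      Y a b * segreRetraction 𝒪 Y g := by
  suffices h : (segreRetraction 𝒪 Y) ∘ₗ LinearMap.mulLeft 𝒪
      (MvPolynomial.X (Sum.inl a) * MvPolynomial.X (Sum.inr b) : MvPolynomial (α ⊕ β) 𝒪) =
      LinearMap.mulLeft 𝒪 (Y a b) ∘ₗ segreRetraction 𝒪 Y from LinearMap.congr_fun h g
  refine (MvPolynomial.basisMonomials (α ⊕ β) 𝒪).ext fun c => ?_
  simp only [MvPolynomial.coe_basisMonomials, LinearMap.comp_apply, LinearMap.mulLeft_apply,
    MvPolynomial.X, MvPolynomial.monomial_mul, one_mul]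
  rw [segreRetraction_monomial, segreRetraction_monomial, ← pairingProd_cons hY]
  simp only [Finsupp.toMultiset_add, Finsupp.toMultiset_single, one_smul,
    Multiset.singleton_add, Multiset.cons_add, Multiset.singleton_add]
  rw [Multiset.filterMap_cons_some Sum.getLeft? (Sum.inl a) (b := a) _ rfl,
    Multiset.filterMap_cons_none (Sum.inr b) _ rfl,
    Multiset.filterMap_cons_none (Sum.inl a) _ rfl,
    Multiset.filterMap_cons_some Sum.getRight? (Sum.inr b) (b := b) _ rfl]

variable {𝒪} {P : Type*} [CommRing P] [Algebra 𝒪 P]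

/-- The pairs `(p, r)` such that a linear map turns multiplication by `p` into multiplication
by `r`. -/
def intertwiners (σ : P →ₗ[𝒪] R) : Subalgebra 𝒪 (P × R) where
  carrier := {x | ∀ g, σ (x.1 * g) = x.2 * σ g}
  mul_mem' {x y} hx hy g := by
    simp only [Set.mem_ofPred_eq] at hx hy
    rw [Prod.fst_mul, Prod.snd_mul, mul_assoc, hx, hy, mul_assoc]
  add_mem' {x y} hx hy g := by
    simp only [Set.mem_ofPred_eq] at hx hy
    rw [Prod.fst_add, Prod.snd_add, add_mul, map_add, hx, hy, add_mul]
  algebraMap_mem' c g := by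
    simp [← Algebra.smul_def]

end Segre

/-! ### The equations of the chart, entry by entry -/

section Relations

variable {m l : ℕ} {R : Type*} [CommRing R]

/-- The equations of the naive chart, for a matrix over any ring. -/
structure NaiveRel (X : Matrix (Idx m l) (Idx m l) R) (π : R) : Prop where
  sq : X * X = 0
  minors : ∀ i i' j j', X i j * X i' j' = X i j' * X i' j
  form₀ : Xᵀ * S₀ R m l * X - (2 * π) • (S₀ R m l * X + π • (S₁ R m l * X)) = 0
  form₁ : Xᵀ * S₁ R m l * X + (2 : R) • (S₀ R m l * X + π • (S₁ R m l * X)) = 0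

/-- The additional equations of the chart, for a matrix over any ring. -/
structure AddRel (X : Matrix (Idx m l) (Idx m l) R) (π : R) : Prop where
  trace : X.trace = 0
  trace_mid : (X.submatrix (midIdx m l) (midIdx m l)).trace + 2 * π = 0
  symm : X.submatrix (midIdx m l) (midIdx m l) * antidiag R l -
    antidiag R l * (X.submatrix (midIdx m l) (midIdx m l))ᵀ = 0
  mid : X.submatrix (midIdx m l) (lstIdx m l) * antidiag R m *
      (X.submatrix (midIdx m l) (fstIdx m l))ᵀ -
    X.submatrix (midIdx m l) (midIdx m l) * antidiag R l = 0

theorem antidiag_mul {ι : Type*} {k : ℕ} (M : Matrix (Fin k) ι R) (i : Fin k) (j : ι) :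
    (antidiag R k * M) i j = M i.rev j := by
  simp [antidiag, Matrix.mul_apply]

theorem mul_antidiag {ι : Type*} {k : ℕ} (M : Matrix ι (Fin k) R) (i : ι) (j : Fin k) :
    (M * antidiag R k) i j = M i j.rev := by
  simp [antidiag, Matrix.mul_apply, Fin.rev_eq_iff, eq_comm (a := j)]

variable (X : Matrix (Idx m l) (Idx m l) R) (j : Idx m l)

theorem S₀_mul_fst (a : Fin m) : (S₀ R m l * X) (fstIdx m l a) j = X (lstIdx m l a.rev) j := by
  simp [S₀, antidiag, Matrix.mul_apply]

theorem S₀_mul_mid (a : Fin l) : (S₀ R m l * X) (midIdx m l a) j = 0 := by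
  simp [S₀, Matrix.mul_apply]

theorem S₀_mul_lst (a : Fin m) : (S₀ R m l * X) (lstIdx m l a) j = X (fstIdx m l a.rev) j := by
  simp [S₀, antidiag, Matrix.mul_apply]

theorem S₁_mul_fst (a : Fin m) : (S₁ R m l * X) (fstIdx m l a) j = 0 := by
  simp [S₁, Matrix.mul_apply]

theorem S₁_mul_mid (a : Fin l) : (S₁ R m l * X) (midIdx m l a) j = X (midIdx m l a.rev) j := by
  simp [S₁, antidiag, Matrix.mul_apply]

theorem S₁_mul_lst (a : Fin m) : (S₁ R m l * X) (lstIdx m l a) j = 0 := by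
  simp [S₁, Matrix.mul_apply]

theorem form₀_apply (i : Idx m l) : (Xᵀ * S₀ R m l * X) i j =
    ∑ a, X (fstIdx m l a) i * X (lstIdx m l a.rev) j +
      ∑ a, X (lstIdx m l a) i * X (fstIdx m l a.rev) j := by
  rw [Matrix.mul_assoc, Matrix.mul_apply, Fintype.sum_sum_type, Fintype.sum_sum_type]
  simp only [Matrix.transpose_apply, S₀_mul_fst, S₀_mul_mid, S₀_mul_lst, mul_zero,
    Finset.sum_const_zero, zero_add]

theorem form₁_apply (i : Idx m l) : (Xᵀ * S₁ R m l * X) i j =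
    ∑ a, X (midIdx m l a) i * X (midIdx m l a.rev) j := by
  rw [Matrix.mul_assoc, Matrix.mul_apply, Fintype.sum_sum_type, Fintype.sum_sum_type]
  simp only [Matrix.transpose_apply, S₁_mul_fst, S₁_mul_mid, S₁_mul_lst, mul_zero,
    Finset.sum_const_zero, zero_add, add_zero]

theorem sum_rev {k : ℕ} (f : Fin k → R) : ∑ a : Fin k, f a.rev = ∑ a, f a :=
  Equiv.sum_comp Fin.revPerm f

variable {X} {π : R}

namespace NaiveRel

/-- Since `S₁X` has no outer rows, the outer rows of `form₁` express `2X` there through the middle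
rows alone. -/
theorem two_mul_fst (hX : NaiveRel X π) (a : Fin m) : 2 * X (fstIdx m l a) j =
    -∑ b, X (midIdx m l b) (lstIdx m l a.rev) * X (midIdx m l b.rev) j := by
  have h := congrFun₂ hX.form₁ (lstIdx m l a.rev) j
  simp only [Matrix.add_apply, Matrix.smul_apply, form₁_apply, S₀_mul_lst, S₁_mul_lst,
    Fin.rev_rev, smul_eq_mul, Matrix.zero_apply] at h
  linear_combination h

theorem two_mul_lst (hX : NaiveRel X π) (a : Fin m) : 2 * X (lstIdx m l a) j =
    -∑ b, X (midIdx m l b) (fstIdx m l a.rev) * X (midIdx m l b.rev) j := by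
  have h := congrFun₂ hX.form₁ (fstIdx m l a.rev) j
  simp only [Matrix.add_apply, Matrix.smul_apply, form₁_apply, S₀_mul_fst, S₁_mul_fst,
    Fin.rev_rev, smul_eq_mul, Matrix.zero_apply] at h
  linear_combination h

theorem two_mul_mid (hX : NaiveRel X π) (a : Fin l) : 2 * π * X (midIdx m l a) j =
    -∑ b, X (midIdx m l b) (midIdx m l a.rev) * X (midIdx m l b.rev) j := by
  have h := congrFun₂ hX.form₁ (midIdx m l a.rev) j
  simp only [Matrix.add_apply, Matrix.smul_apply, form₁_apply, S₀_mul_mid, S₁_mul_mid,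
    Fin.rev_rev, smul_eq_mul, Matrix.zero_apply] at h
  linear_combination h

/-- Adding `π` times `form₁` to `form₀` cancels the terms linear in `X`. -/
theorem form₀_eq (hX : NaiveRel X π) (i : Idx m l) : ∑ a, X (fstIdx m l a) i * X (lstIdx m l a.rev) j +
      ∑ a, X (lstIdx m l a) i * X (fstIdx m l a.rev) j =
    -π * ∑ a, X (midIdx m l a) i * X (midIdx m l a.rev) j := by
  have h₀ := congrFun₂ hX.form₀ i j
  have h₁ := congrFun₂ hX.form₁ i j
  simp only [Matrix.add_apply, Matrix.sub_apply, Matrix.smul_apply, form₀_apply, form₁_apply,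
    smul_eq_mul, Matrix.zero_apply] at h₀ h₁
  linear_combination h₀ + π * h₁

end NaiveRel

theorem AddRel.mid_eq (hX : AddRel X π) (a b : Fin l) : X (midIdx m l a) (midIdx m l b) =
    ∑ k, X (midIdx m l a) (lstIdx m l k.rev) * X (midIdx m l b.rev) (fstIdx m l k) := by
  have h := congrFun₂ hX.mid a b.rev
  simp only [Matrix.sub_apply, mul_antidiag, Fin.rev_rev, Matrix.mul_apply (M := _ * _),
    Matrix.submatrix_apply, Matrix.transpose_apply, Matrix.zero_apply] at h
  linear_combination -h

end Relations

/-! ### Rank one solutions -/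

section RankOne

variable {m l : ℕ} {R : Type*} [CommRing R] {X : Matrix (Idx m l) (Idx m l) R} {π : R}

/-- Away from `π = 0` and `X = 0` the equations of the naive chart imply the additional ones. -/
theorem NaiveRel.addRel [IsLocalRing R] (hX : NaiveRel X π) (h2 : IsUnit (2 : R))
    (hπ : IsUnit π) {i₀ j₀ : Idx m l} (h₀ : IsUnit (X i₀ j₀)) : AddRel X π := by
  -- Twice an outer entry is a combination of middle entries of the same column, and in a local ring
  -- a unit sum has a unit summand.
  obtain ⟨a₀, ha₀⟩ : ∃ a₀, IsUnit (X (midIdx m l a₀) j₀) := by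
    have key : ∀ f : Fin l → R,
        IsUnit (-∑ b : Fin l, f b * X (midIdx m l b.rev) j₀) →
          ∃ a₀, IsUnit (X (midIdx m l a₀) j₀) := by
      intro f hf
      obtain ⟨b, -, hb⟩ := IsLocalRing.exists_of_isUnit_sum (IsUnit.neg_iff _ |>.1 hf)
      exact ⟨b.rev, isUnit_of_mul_isUnit_right hb⟩
    rcases i₀ with a | a | a
    · exact key _ (hX.two_mul_fst j₀ a ▸ h2.mul h₀)
    · exact ⟨a, h₀⟩
    · exact key _ (hX.two_mul_lst j₀ a ▸ h2.mul h₀)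
  obtain ⟨c, hc⟩ := ha₀.exists_right_inv
  -- The minors factor the middle rows as `u wᵗ`, with `w` normalised by `w j₀ = 1`.
  obtain ⟨u, hu⟩ : ∃ u : Fin l → R, ∀ a, u a = X (midIdx m l a) j₀ := ⟨_, fun _ => rfl⟩
  obtain ⟨w, hw⟩ : ∃ w : Idx m l → R, ∀ j, w j = X (midIdx m l a₀) j * c := ⟨_, fun _ => rfl⟩
  have hM : ∀ a j, X (midIdx m l a) j = u a * w j := fun a j => by
    rw [hu, hw]
    linear_combination (-X (midIdx m l a) j) * hc - c * hX.minors (midIdx m l a) (midIdx m l a₀) j₀ j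
  have hw₀ : w j₀ = 1 := by rw [hw, hc]
  obtain ⟨s, hs⟩ : ∃ s : R, s = ∑ a, u a * u a.rev := ⟨_, rfl⟩
  have hsum : ∀ i j, ∑ b : Fin l, X (midIdx m l b) i * X (midIdx m l b.rev) j =
      s * (w i * w j) := fun i j => by
    rw [hs, Finset.sum_mul]
    exact Finset.sum_congr rfl fun b _ => by rw [hM, hM]; ring
  have hmid : ∀ a : Fin l, s * w (midIdx m l a) = -(2 * π) * u a.rev := fun a => by
    have h := hX.two_mul_mid j₀ a.rev
    rw [hsum, Fin.rev_rev, hw₀, hM, hw₀] at h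
    linear_combination h
  have hfst : ∀ (a : Fin m) j, 2 * X (fstIdx m l a) j = -(s * (w (lstIdx m l a.rev) * w j)) :=
    fun a j => by rw [hX.two_mul_fst, hsum]
  have hlst : ∀ (a : Fin m) j, 2 * X (lstIdx m l a) j = -(s * (w (fstIdx m l a.rev) * w j)) :=
    fun a j => by rw [hX.two_mul_lst, hsum]
  -- This is where `π` must be invertible; every additional equation is then checked after
  -- multiplication by `s`.
  have hsu : IsUnit s := by
    refine isUnit_of_mul_isUnit_left (y := w (midIdx m l a₀.rev)) ?_
    rw [hmid, Fin.rev_rev, hu]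
    exact (h2.mul hπ).neg.mul ha₀
  obtain ⟨t, ht⟩ : ∃ t : R, t = ∑ k : Fin m, w (lstIdx m l k.rev) * w (fstIdx m l k) := ⟨_, rfl⟩
  -- The `(j₀, j₀)` entry of `form₀_eq` reads `s²t/2 = -πs`.
  have hst : s * t = -(2 * π) := by
    have h := hX.form₀_eq j₀ j₀
    rw [hsum, hw₀] at h
    have h₁ : 4 * ∑ a : Fin m, X (fstIdx m l a) j₀ * X (lstIdx m l a.rev) j₀ = s ^ 2 * t := by
      rw [ht, Finset.mul_sum, Finset.mul_sum]
      refine Finset.sum_congr rfl fun a _ => ?_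
      have e₁ := hfst a j₀
      have e₂ := hlst a.rev j₀
      rw [hw₀] at e₁ e₂
      rw [Fin.rev_rev] at e₂
      linear_combination (2 * X (lstIdx m l a.rev) j₀) * e₁ - (s * w (lstIdx m l a.rev)) * e₂
    have h₂ : ∑ a : Fin m, X (lstIdx m l a) j₀ * X (fstIdx m l a.rev) j₀ =
        ∑ a : Fin m, X (fstIdx m l a) j₀ * X (lstIdx m l a.rev) j₀ := by
      rw [← sum_rev]
      exact Finset.sum_congr rfl fun a _ => by rw [Fin.rev_rev, mul_comm]
    rw [h₂] at h
    refine (h2.mul hsu).mul_left_cancel ?_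
    linear_combination 4 * h - 2 * h₁
  refine ⟨?_, ?_, ?_, ?_⟩
  -- The minors turn the `(a₀, j₀)` entry of `X²` into that entry of `X` times `Tr X`.
  · refine ha₀.mul_left_cancel ?_
    have h := congrFun₂ hX.sq (midIdx m l a₀) j₀
    rw [Matrix.mul_apply, Matrix.zero_apply] at h
    rw [mul_zero, ← h, Matrix.trace, Finset.mul_sum]
    exact Finset.sum_congr rfl fun k _ => by
      rw [Matrix.diag_apply, hX.minors]
  · refine hsu.mul_left_cancel ?_
    have : s * ∑ a, X (midIdx m l a) (midIdx m l a) = -(2 * π) * s := by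
      conv_rhs => rw [hs]
      rw [Finset.mul_sum, Finset.mul_sum]
      exact Finset.sum_congr rfl fun a _ => by
        rw [hM]; linear_combination u a * hmid a
    simp only [Matrix.trace, Matrix.diag_apply, Matrix.submatrix_apply]
    linear_combination this
  · ext a b
    refine hsu.mul_left_cancel ?_
    simp only [Matrix.sub_apply, mul_antidiag, antidiag_mul, Matrix.submatrix_apply,
      Matrix.transpose_apply, Matrix.zero_apply]
    rw [hM, hM]
    have e₁ := hmid a.rev
    have e₂ := hmid b.rev
    rw [Fin.rev_rev] at e₁ e₂
    linear_combination u a * e₂ - u b * e₁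
  · ext a b
    refine hsu.mul_left_cancel ?_
    simp only [Matrix.sub_apply, mul_antidiag, Matrix.mul_apply (M := _ * _),
      Matrix.submatrix_apply, Matrix.transpose_apply, Matrix.zero_apply]
    have : ∑ k : Fin m, X (midIdx m l a) (lstIdx m l k.rev) * X (midIdx m l b) (fstIdx m l k) =
        u a * u b * t := by
      rw [ht, Finset.mul_sum]
      exact Finset.sum_congr rfl fun k _ => by rw [hM, hM]; ring
    rw [this, hM]
    have e₂ := hmid b.rev
    rw [Fin.rev_rev] at e₂
    linear_combination u a * u b * hst - u a * e₂

/-- The matrix `z wᵗ` with `z = (-(s/2) J v₂, u, -(s/2) J v₁)` and `w = (v₁, t J u, v₂)`, where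
`s = uᵗ J u`, `t = v₂ᵗ J v₁`, and `h` stands for `1/2`. -/
def rankOne (h : R) (u : Fin l → R) (v₁ v₂ : Fin m → R) : Matrix (Idx m l) (Idx m l) R :=
  Matrix.vecMulVec
    (Sum.elim (fun a => -(h * ∑ b, u b * u b.rev) * v₂ a.rev)
      (Sum.elim u fun a => -(h * ∑ b, u b * u b.rev) * v₁ a.rev))
    (Sum.elim v₁ (Sum.elim (fun b => (∑ k : Fin m, v₂ k.rev * v₁ k) * u b.rev) v₂))

variable {h : R} {u : Fin l → R} {v₁ v₂ : Fin m → R}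

theorem sum_mul_rev_comm (v₁ v₂ : Fin m → R) :
    ∑ k : Fin m, v₁ k.rev * v₂ k = ∑ k : Fin m, v₂ k.rev * v₁ k := by
  rw [← sum_rev]
  exact Finset.sum_congr rfl fun a _ => by rw [Fin.rev_rev, mul_comm]

theorem rankOne_naiveRel (hh : 2 * h = 1)
    (hst : (∑ b, u b * u b.rev) * (∑ k : Fin m, v₂ k.rev * v₁ k) + 2 * π = 0) :
    NaiveRel (rankOne h u v₁ v₂) π := by
  have hcomm := sum_mul_rev_comm v₁ v₂
  obtain ⟨z, hz⟩ : ∃ z, z = (Sum.elim (fun a => -(h * ∑ b, u b * u b.rev) * v₂ a.rev)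
      (Sum.elim u fun a => -(h * ∑ b, u b * u b.rev) * v₁ a.rev) : Idx m l → R) := ⟨_, rfl⟩
  obtain ⟨w, hw⟩ : ∃ w, w = (Sum.elim v₁ (Sum.elim (fun b => (∑ k : Fin m, v₂ k.rev * v₁ k) *
      u b.rev) v₂) : Idx m l → R) := ⟨_, rfl⟩
  have hX : rankOne h u v₁ v₂ = Matrix.vecMulVec z w := by rw [hz, hw, rankOne]
  obtain ⟨s, hs⟩ : ∃ s, s = ∑ b, u b * u b.rev := ⟨_, rfl⟩
  obtain ⟨t, ht⟩ : ∃ t, t = ∑ k : Fin m, v₂ k.rev * v₁ k := ⟨_, rfl⟩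
  rw [← hs] at hst hz
  rw [← ht] at hst hw hcomm
  rw [hX]
  -- The vector `w` is chosen so that `(S₀ + πS₁)z = -(s/2)w`; only the middle block needs `st =
  -- -2π`.
  have hS : S₀ R m l * Matrix.vecMulVec z w + π • (S₁ R m l * Matrix.vecMulVec z w) =
      (-(h * s)) • Matrix.vecMulVec w w := by
    ext (a | a | a) j
    · rw [Matrix.add_apply, Matrix.smul_apply, S₀_mul_fst, S₁_mul_fst]
      simp [hz, hw, Matrix.vecMulVec_apply]
      ring
    · rw [Matrix.add_apply, Matrix.smul_apply, S₀_mul_mid, S₁_mul_mid]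
      simp only [hz, hw, Matrix.vecMulVec_apply, Sum.elim_inl, Sum.elim_inr, smul_eq_mul,
        Matrix.smul_apply]
      generalize Sum.elim v₁ _ j = y
      linear_combination (-π * u a.rev * y) * hh + (h * u a.rev * y) * hst
    · rw [Matrix.add_apply, Matrix.smul_apply, S₀_mul_lst, S₁_mul_lst]
      simp [hz, hw, Matrix.vecMulVec_apply]
      ring
  refine ⟨?_, ?_, ?_, ?_⟩
  -- The three blocks contribute `-st/2`, `st` and `-st/2`.
  · have : w ⬝ᵥ z = 0 := by
      have e₁ : ∑ a : Fin m, v₁ a * (-(h * s) * v₂ a.rev) = -(h * s) * t := by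
        rw [ht, Finset.mul_sum]
        exact Finset.sum_congr rfl fun a _ => by ring
      have e₂ : ∑ a : Fin l, t * u a.rev * u a = t * s := by
        rw [hs, Finset.mul_sum]
        exact Finset.sum_congr rfl fun a _ => by ring
      have e₃ : ∑ a : Fin m, v₂ a * (-(h * s) * v₁ a.rev) = -(h * s) * t := by
        rw [← hcomm, Finset.mul_sum]
        exact Finset.sum_congr rfl fun a _ => by ring
      rw [dotProduct, Fintype.sum_sum_type, Fintype.sum_sum_type]
      simp only [hz, hw, Sum.elim_inl, Sum.elim_inr]
      rw [e₁, e₂, e₃]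
      linear_combination (-s * t) * hh
    rw [Matrix.vecMulVec_mul_vecMulVec, this]
    simp
  · intro i i' j j'
    simp only [Matrix.vecMulVec_apply]
    ring
  · rw [hS]
    ext i j
    rw [Matrix.sub_apply, form₀_apply]
    have e₁ : ∑ a : Fin m, Matrix.vecMulVec z w (fstIdx m l a) i *
        Matrix.vecMulVec z w (lstIdx m l a.rev) j = (h * s) ^ 2 * t * (w i * w j) := by
      rw [ht, Finset.mul_sum, Finset.sum_mul]
      refine Finset.sum_congr rfl fun a _ => ?_
      simp only [Matrix.vecMulVec_apply]
      simp only [hz, Sum.elim_inl, Sum.elim_inr, Fin.rev_rev]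
      ring
    have e₂ : ∑ a : Fin m, Matrix.vecMulVec z w (lstIdx m l a) i *
        Matrix.vecMulVec z w (fstIdx m l a.rev) j = (h * s) ^ 2 * t * (w i * w j) := by
      rw [← hcomm, Finset.mul_sum, Finset.sum_mul]
      refine Finset.sum_congr rfl fun a _ => ?_
      simp only [Matrix.vecMulVec_apply]
      simp only [hz, Sum.elim_inl, Sum.elim_inr, Fin.rev_rev]
      ring
    rw [e₁, e₂]
    simp only [Matrix.smul_apply, Matrix.vecMulVec_apply, Matrix.zero_apply, smul_eq_mul]
    linear_combination (2 * h ^ 2 * s * w i * w j) * hst - (2 * π * h * s * w i * w j) * hh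
  · rw [hS]
    ext i j
    rw [Matrix.add_apply, form₁_apply]
    have e : ∑ a : Fin l, Matrix.vecMulVec z w (midIdx m l a) i *
        Matrix.vecMulVec z w (midIdx m l a.rev) j = s * (w i * w j) := by
      rw [hs, Finset.sum_mul]
      refine Finset.sum_congr rfl fun a _ => ?_
      simp only [Matrix.vecMulVec_apply]
      simp only [hz, Sum.elim_inl, Sum.elim_inr]
      ring
    rw [e]
    simp only [Matrix.smul_apply, Matrix.vecMulVec_apply, Matrix.zero_apply, smul_eq_mul]
    linear_combination (-s * w i * w j) * hh

/-- This and the next two identities need no relation between `s`, `t` and `π`, so they hold in `P`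
before passing to the quotient by `q`. They mirror `AddRel.mid_eq`, `NaiveRel.two_mul_fst` and
`NaiveRel.two_mul_lst`. -/
theorem rankOne_mid_eq (a b : Fin l) : rankOne h u v₁ v₂ (midIdx m l a) (midIdx m l b) =
    ∑ k, rankOne h u v₁ v₂ (midIdx m l a) (lstIdx m l k.rev) *
      rankOne h u v₁ v₂ (midIdx m l b.rev) (fstIdx m l k) := by
  simp only [rankOne, Matrix.vecMulVec_apply, Sum.elim_inl, Sum.elim_inr]
  rw [Finset.sum_mul, Finset.mul_sum]
  exact Finset.sum_congr rfl fun k _ => by ring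

theorem rankOne_fst_eq (a : Fin m) (j : Idx m l) : rankOne h u v₁ v₂ (fstIdx m l a) j =
    -h * ∑ b, rankOne h u v₁ v₂ (midIdx m l b) (lstIdx m l a.rev) *
      rankOne h u v₁ v₂ (midIdx m l b.rev) j := by
  simp only [rankOne, Matrix.vecMulVec_apply, Sum.elim_inl, Sum.elim_inr]
  generalize Sum.elim v₁ _ j = y
  rw [Finset.mul_sum, Finset.mul_sum, ← Finset.sum_neg_distrib, Finset.sum_mul, Finset.sum_mul]
  exact Finset.sum_congr rfl fun k _ => by ring

theorem rankOne_lst_eq (a : Fin m) (j : Idx m l) : rankOne h u v₁ v₂ (lstIdx m l a) j =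
    -h * ∑ b, rankOne h u v₁ v₂ (midIdx m l b) (fstIdx m l a.rev) *
      rankOne h u v₁ v₂ (midIdx m l b.rev) j := by
  simp only [rankOne, Matrix.vecMulVec_apply, Sum.elim_inl, Sum.elim_inr]
  generalize Sum.elim v₁ _ j = y
  rw [Finset.mul_sum, Finset.mul_sum, ← Finset.sum_neg_distrib, Finset.sum_mul, Finset.sum_mul]
  exact Finset.sum_congr rfl fun k _ => by ring

theorem rankOne_trace_mid : ((rankOne h u v₁ v₂).submatrix (midIdx m l) (midIdx m l)).trace =
    (∑ b, u b * u b.rev) * ∑ k : Fin m, v₂ k.rev * v₁ k := by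
  simp only [Matrix.trace, Matrix.diag_apply, Matrix.submatrix_apply, rankOne,
    Matrix.vecMulVec_apply, Sum.elim_inl, Sum.elim_inr]
  rw [Finset.sum_mul]
  exact Finset.sum_congr rfl fun k _ => by ring

theorem rankOne_addRel (hh : 2 * h = 1)
    (hst : (∑ b, u b * u b.rev) * (∑ k : Fin m, v₂ k.rev * v₁ k) + 2 * π = 0) :
    AddRel (rankOne h u v₁ v₂) π := by
  refine ⟨?_, ?_, ?_, ?_⟩
  · have hcomm := sum_mul_rev_comm v₁ v₂
    rw [Matrix.trace, Fintype.sum_sum_type, Fintype.sum_sum_type]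
    have e := rankOne_trace_mid (h := h) (u := u) (v₁ := v₁) (v₂ := v₂)
    simp only [Matrix.trace, Matrix.diag_apply, Matrix.submatrix_apply] at e
    simp only [Matrix.diag_apply]
    rw [e]
    simp only [rankOne, Matrix.vecMulVec_apply, Sum.elim_inl, Sum.elim_inr, mul_assoc,
      neg_mul, Finset.sum_neg_distrib, ← Finset.mul_sum]
    rw [hcomm]
    linear_combination (-(∑ b, u b * u b.rev) * (∑ k : Fin m, v₂ k.rev * v₁ k)) * hh
  · rw [rankOne_trace_mid, hst]
  · ext a b
    simp only [Matrix.sub_apply, mul_antidiag, antidiag_mul, Matrix.submatrix_apply,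
      Matrix.transpose_apply, Matrix.zero_apply, rankOne, Matrix.vecMulVec_apply, Sum.elim_inl,
      Sum.elim_inr, Fin.rev_rev]
    ring
  · ext a b
    simp only [Matrix.sub_apply, mul_antidiag, Matrix.mul_apply (M := _ * _),
      Matrix.submatrix_apply, Matrix.transpose_apply, Matrix.zero_apply]
    rw [rankOne_mid_eq, Fin.rev_rev, sub_self]

end RankOne

/-! ### Ideals versus equations, and the scheme-theoretic closure -/

section Ideals

variable {m l : ℕ} {R R' : Type*} [CommRing R] [CommRing R']

theorem entries_subset_ker_iff {ι κ : Type*} (f : R →+* R') (M : Matrix ι κ R) :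
    entries M ⊆ (RingHom.ker f : Set R) ↔ M.map f = 0 := by
  rw [entries, Set.range_subset_iff, ← Matrix.ext_iff]
  exact Prod.forall

theorem minors₂_subset_ker_iff {ι κ : Type*} (f : R →+* R') (M : Matrix ι κ R) :
    minors₂ M ⊆ (RingHom.ker f : Set R) ↔
      ∀ i i' j j', M.map f i j * M.map f i' j' = M.map f i j' * M.map f i' j := by
  simp only [minors₂, Set.range_subset_iff, Prod.forall, SetLike.mem_coe, RingHom.mem_ker,
    map_sub, map_mul, sub_eq_zero, Matrix.map_apply]

theorem smul_map {ι κ : Type*} (f : R →+* R') (c : R) (M : Matrix ι κ R) :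
    (c • M).map f = f c • M.map f := by
  ext i j
  simp

theorem antidiag_map (f : R →+* R') (k : ℕ) : (antidiag R k).map f = antidiag R' k := by
  ext i j
  simp [antidiag, apply_ite f]

theorem S₀_map (f : R →+* R') : (S₀ R m l).map f = S₀ R' m l := by
  ext (i | i | i) (j | j | j) <;> simp [S₀, antidiag, apply_ite f]

theorem S₁_map (f : R →+* R') : (S₁ R m l).map f = S₁ R' m l := by
  ext (i | i | i) (j | j | j) <;> simp [S₁, antidiag, apply_ite f]

variable {𝒪 : Type*} [CommRing 𝒪] (π : 𝒪)

theorem naiveIdeal_le_ker_iff (f : PolyRing 𝒪 m l →+* R) :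
    naiveIdeal m l π ≤ RingHom.ker f ↔
      NaiveRel ((genericX 𝒪 m l).map f) (f (MvPolynomial.C π)) := by
  simp only [naiveIdeal, Ideal.span_le, Set.union_subset_iff, entries_subset_ker_iff,
    minors₂_subset_ker_iff, Matrix.map_sub f (map_sub f), Matrix.map_add f (map_add f),
    Matrix.map_mul, smul_map, map_mul, map_ofNat, Matrix.transpose_map, S₀_map, S₁_map]
  exact ⟨fun h => ⟨h.1.1.1, h.1.1.2, h.1.2, h.2⟩, fun h => ⟨⟨⟨h.1, h.2⟩, h.3⟩, h.4⟩⟩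

theorem addIdeal_le_ker_iff (f : PolyRing 𝒪 m l →+* R) :
    addIdeal m l π ≤ RingHom.ker f ↔
      AddRel ((genericX 𝒪 m l).map f) (f (MvPolynomial.C π)) := by
  simp only [addIdeal, Ideal.span_le, Set.union_subset_iff, entries_subset_ker_iff,
    Set.singleton_subset_iff, SetLike.mem_coe, RingHom.mem_ker, map_add,
    Matrix.map_sub f (map_sub f), Matrix.map_mul, map_mul, map_ofNat, Matrix.transpose_map,
    antidiag_map, AddMonoidHom.map_trace, blockA, blockB₁, blockB₂, ← Matrix.submatrix_map]
  exact ⟨fun h => ⟨h.1.1.1, h.1.1.2, h.1.2, h.2⟩, fun h => ⟨⟨⟨h.1, h.2⟩, h.3⟩, h.4⟩⟩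

theorem chartIdeal_le_ker_iff (f : PolyRing 𝒪 m l →+* R) :
    chartIdeal m l π ≤ RingHom.ker f ↔
      NaiveRel ((genericX 𝒪 m l).map f) (f (MvPolynomial.C π)) ∧
        AddRel ((genericX 𝒪 m l).map f) (f (MvPolynomial.C π)) := by
  rw [chartIdeal, Submodule.add_eq_sup, sup_le_iff, naiveIdeal_le_ker_iff, addIdeal_le_ker_iff]

theorem mem_closureIdeal_iff {J : Ideal R} {g f : R} :
    f ∈ closureIdeal J g ↔ ∃ N : ℕ, g ^ N * f ∈ J := by
  rw [closureIdeal, RingHom.mem_ker, RingHom.comp_apply,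
    IsLocalization.map_eq_zero_iff (Submonoid.powers (Ideal.Quotient.mk J g))]
  constructor
  · rintro ⟨⟨_, N, rfl⟩, h⟩
    exact ⟨N, by rw [← Ideal.Quotient.eq_zero_iff_mem]; simpa using h⟩
  · rintro ⟨N, h⟩
    exact ⟨⟨_, N, rfl⟩, by simpa using Ideal.Quotient.eq_zero_iff_mem.2 h⟩

theorem le_closureIdeal (J : Ideal R) (g : R) : J ≤ closureIdeal J g := fun f hf =>
  mem_closureIdeal_iff.2 ⟨0, by simpa using hf⟩

/-- Vanishing in the localization can be tested in its local rings, where `NaiveRel.addRel` applies.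
-/
theorem addIdeal_le_closureIdeal (h2 : IsUnit (2 : 𝒪)) (p : Idx m l × Idx m l) :
    addIdeal m l π ≤
      closureIdeal (naiveIdeal m l π) (MvPolynomial.C π * MvPolynomial.X p) := by
  set g : PolyRing 𝒪 m l := MvPolynomial.C π * MvPolynomial.X p
  set L := Localization.Away (Ideal.Quotient.mk (naiveIdeal m l π) g)
  let F : PolyRing 𝒪 m l →+* L := (algebraMap _ L).comp (Ideal.Quotient.mk (naiveIdeal m l π))
  intro f hf
  refine eq_zero_of_localization (F f) fun 𝔪 h𝔪 => ?_
  let G : PolyRing 𝒪 m l →+* Localization.AtPrime 𝔪 := (algebraMap _ _).comp F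
  have hg : IsUnit (G (MvPolynomial.C π) * G (MvPolynomial.X p)) := by
    rw [← map_mul]
    exact (IsLocalization.Away.algebraMap_isUnit (S := L)
      (Ideal.Quotient.mk (naiveIdeal m l π) g)).map (algebraMap L (Localization.AtPrime 𝔪))
  have hN : NaiveRel ((genericX 𝒪 m l).map G) (G (MvPolynomial.C π)) := by
    rw [← naiveIdeal_le_ker_iff]
    intro x hx
    simp [G, F, Ideal.Quotient.eq_zero_iff_mem.2 hx]
  have h2' : IsUnit (2 : Localization.AtPrime 𝔪) := by
    rw [← map_ofNat (G.comp MvPolynomial.C) 2]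
    exact h2.map _
  exact (addIdeal_le_ker_iff π G).2 (hN.addRel h2' (isUnit_of_mul_isUnit_left hg)
    (i₀ := p.1) (j₀ := p.2) (isUnit_of_mul_isUnit_right hg)) hf

theorem chartIdeal_eq_iInf_closureIdeal (h2 : IsUnit (2 : 𝒪))
    (hπ : algebraMap 𝒪 (ChartRing m l π) π ∈ nonZeroDivisors (ChartRing m l π)) :
    chartIdeal m l π = ⨅ p : Idx m l × Idx m l,
      closureIdeal (naiveIdeal m l π) (MvPolynomial.C π * MvPolynomial.X p) := by
  refine le_antisymm (le_iInf fun p => sup_le (le_closureIdeal _ _)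
    (addIdeal_le_closureIdeal π h2 p)) fun f hf => ?_
  rw [Ideal.mem_iInf] at hf
  set mk := Ideal.Quotient.mk (chartIdeal m l π)
  rw [← Ideal.Quotient.eq_zero_iff_mem]
  -- Regularity of `π` strips it from `(π x)^N f = 0`, so every entry of `X` lies in the radical of
  -- the annihilator of `f`. Then so does `2π = -Tr A`, and a power of the regular element `π` kills
  -- `f`.
  let K : Ideal (ChartRing m l π) := (Ideal.span {mk f}).annihilator
  have hK : ∀ y, y ∈ K ↔ y * mk f = 0 := fun y => by
    simp [K]
  have hx : ∀ p, mk (MvPolynomial.X p) ∈ K.radical := fun p => by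
    obtain ⟨N, hN⟩ := mem_closureIdeal_iff.1 (hf p)
    refine ⟨N, (hK _).2 ?_⟩
    have h : mk _ = 0 := Ideal.Quotient.eq_zero_iff_mem.2 ((le_sup_left :
      naiveIdeal m l π ≤ naiveIdeal m l π ⊔ addIdeal m l π) hN)
    rw [mul_pow, mul_assoc, map_mul, map_pow] at h
    have h' := (mul_left_mem_nonZeroDivisors_eq_zero_iff (pow_mem hπ N)).1 h
    simpa using h'
  have htr := ((chartIdeal_le_ker_iff π mk).1 (by rw [Ideal.mk_ker])).2.trace_mid
  have h2π : 2 * mk (MvPolynomial.C π) ∈ K.radical := by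
    rw [eq_neg_of_add_eq_zero_right htr]
    exact neg_mem (sum_mem fun a _ => hx (midIdx m l a, midIdx m l a))
  have h2' : IsUnit (2 : ChartRing m l π) := by
    rw [← map_ofNat (algebraMap 𝒪 (ChartRing m l π)) 2]
    exact h2.map _
  obtain ⟨N, hN⟩ := (Ideal.unit_mul_mem_iff_mem _ h2').1 h2π
  exact (mul_left_mem_nonZeroDivisors_eq_zero_iff (pow_mem hπ N)).1 ((hK _).1 hN)

end Ideals

/-! ### The chart ideal as a preimage, and regularity of the uniformizer -/

section Parametrization

variable {m l : ℕ} {𝒪 : Type*} [CommRing 𝒪]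

variable (m l) in
/-- The map from the coordinate ring of matrices to a polynomial ring given by the matrix
`rankOne` in indeterminates. -/
noncomputable def rankOneHom (h : 𝒪) :
    PolyRing 𝒪 m l →ₐ[𝒪] MvPolynomial (Fin l ⊕ (Fin m ⊕ Fin m)) 𝒪 :=
  MvPolynomial.aeval fun p => rankOne (MvPolynomial.C h) (fun a => MvPolynomial.X (Sum.inl a))
    (fun k => MvPolynomial.X (Sum.inr (Sum.inl k)))
    (fun k => MvPolynomial.X (Sum.inr (Sum.inr k))) p.1 p.2

variable (m l) in
/-- The equation `uᵗ J u · v₂ᵗ J v₁ + 2π`. -/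
noncomputable def quartic (π : 𝒪) : MvPolynomial (Fin l ⊕ (Fin m ⊕ Fin m)) 𝒪 :=
  (∑ b : Fin l, MvPolynomial.X (Sum.inl b) * MvPolynomial.X (Sum.inl b.rev)) *
    (∑ k : Fin m, MvPolynomial.X (Sum.inr (Sum.inr k.rev)) * MvPolynomial.X (Sum.inr (Sum.inl k))) +
      2 * MvPolynomial.C π

theorem genericX_map_rankOneHom (h : 𝒪) : (genericX 𝒪 m l).map (rankOneHom m l h) =
    rankOne (MvPolynomial.C h) (fun a => MvPolynomial.X (Sum.inl a))
      (fun k => MvPolynomial.X (Sum.inr (Sum.inl k)))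
      (fun k => MvPolynomial.X (Sum.inr (Sum.inr k))) := by
  ext i j
  simp [genericX, rankOneHom]

theorem rankOne_map {R R' : Type*} [CommRing R] [CommRing R'] (f : R →+* R') (h : R)
    (u : Fin l → R) (v₁ v₂ : Fin m → R) :
    (rankOne h u v₁ v₂).map f = rankOne (f h) (f ∘ u) (f ∘ v₁) (f ∘ v₂) := by
  ext (i | i | i) (j | j | j) <;> simp [rankOne, Matrix.vecMulVec_apply]

theorem chartIdeal_le_ker_comp_rankOneHom {R : Type*} [CommRing R] {π h : 𝒪} (hh : 2 * h = 1)
    (q : MvPolynomial (Fin l ⊕ (Fin m ⊕ Fin m)) 𝒪 →+* R) (hq : q (quartic m l π) = 0) :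
    chartIdeal m l π ≤ RingHom.ker (q.comp (rankOneHom m l h).toRingHom) := by
  have hhq : 2 * q (MvPolynomial.C h) = 1 := by
    rw [← map_ofNat q 2, ← map_mul, ← map_ofNat MvPolynomial.C 2, ← map_mul, hh, map_one, map_one]
  have hX : (genericX 𝒪 m l).map (q.comp (rankOneHom m l h).toRingHom) =
      rankOne (q (MvPolynomial.C h)) (q ∘ fun a => MvPolynomial.X (Sum.inl a))
        (q ∘ fun k => MvPolynomial.X (Sum.inr (Sum.inl k)))
        (q ∘ fun k => MvPolynomial.X (Sum.inr (Sum.inr k))) := by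
    rw [← rankOne_map, ← genericX_map_rankOneHom]
    rfl
  have hπ : (q.comp (rankOneHom m l h).toRingHom) (MvPolynomial.C π) = q (MvPolynomial.C π) := by
    simp [rankOneHom]
  simp only [quartic, map_add, map_mul, map_sum, map_ofNat] at hq
  rw [chartIdeal_le_ker_iff, hX, hπ]
  exact ⟨rankOne_naiveRel hhq hq, rankOne_addRel hhq hq⟩

theorem rankOneHom_mem_span_quartic {π h : 𝒪} (hh : 2 * h = 1) {f : PolyRing 𝒪 m l}
    (hf : f ∈ chartIdeal m l π) : rankOneHom m l h f ∈ Ideal.span {quartic m l π} :=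
  Ideal.Quotient.eq_zero_iff_mem.1 <| chartIdeal_le_ker_comp_rankOneHom hh
    (Ideal.Quotient.mk (Ideal.span {quartic m l π}))
    (Ideal.Quotient.eq_zero_iff_mem.2 (Ideal.mem_span_singleton_self _)) hf

/-- The entries of `B₁` and `B₂` map to the monomials `u_a v_k`, so the Segre map intertwines them.
All other entries are the same polynomials in these on both sides, and intertwined pairs form a
subalgebra. -/
theorem mem_chartIdeal_of_rankOneHom_mem {π h : 𝒪} (hh : 2 * h = 1) {f : PolyRing 𝒪 m l}
    (hf : rankOneHom m l h f ∈ Ideal.span {quartic m l π}) : f ∈ chartIdeal m l π := by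
  set mk := Ideal.Quotient.mkₐ 𝒪 (chartIdeal m l π)
  obtain ⟨hN, hA⟩ := (chartIdeal_le_ker_iff π (mk : PolyRing 𝒪 m l →+* ChartRing m l π)).1
    fun _ => Ideal.Quotient.eq_zero_iff_mem.2
  set x := (genericX 𝒪 m l).map (mk : PolyRing 𝒪 m l →+* ChartRing m l π)
  set y := (genericX 𝒪 m l).map (rankOneHom m l h) 
  have hy : y = rankOne _ _ _ _ := genericX_map_rankOneHom h
  let Y : Fin l → Fin m ⊕ Fin m → ChartRing m l π := fun a =>
    Sum.elim (fun k => x (midIdx m l a) (fstIdx m l k)) fun k => x (midIdx m l a) (lstIdx m l k)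
  have hY : ∀ a a' b b', Y a b * Y a' b' = Y a b' * Y a' b := by
    rintro a a' (b | b) (b' | b') <;> exact hN.minors _ _ _ _
  let σ := segreRetraction 𝒪 Y
  have hhx : ∀ c d : ChartRing m l π, 2 * c = -d →
      c = algebraMap 𝒪 _ (-h) * d := fun c d hcd => by
    have : 2 * algebraMap 𝒪 (ChartRing m l π) h = 1 := by
      rw [← map_ofNat (algebraMap 𝒪 (ChartRing m l π)) 2, ← map_mul, hh, map_one]
    rw [map_neg]
    linear_combination (-c) * this + algebraMap 𝒪 (ChartRing m l π) h * hcd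
  have hfst : ∀ a k, (y (midIdx m l a) (fstIdx m l k), x (midIdx m l a) (fstIdx m l k)) ∈
      intertwiners σ := fun a k g => by
    rw [hy]
    exact segreRetraction_mul 𝒪 hY a (Sum.inl k) g
  have hlst : ∀ a k, (y (midIdx m l a) (lstIdx m l k), x (midIdx m l a) (lstIdx m l k)) ∈
      intertwiners σ := fun a k g => by
    rw [hy]
    exact segreRetraction_mul 𝒪 hY a (Sum.inr k) g
  have hmid : ∀ a j, (y (midIdx m l a) j, x (midIdx m l a) j) ∈ intertwiners σ := by
    rintro a (k | b | k)
    · exact hfst a k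
    · have h₁ : y (midIdx m l a) (midIdx m l b) =
          ∑ k, y (midIdx m l a) (lstIdx m l k.rev) * y (midIdx m l b.rev) (fstIdx m l k) := by
        rw [hy]
        exact rankOne_mid_eq a b
      have h₂ := hA.mid_eq a b
      have := sum_mem fun k (_ : k ∈ Finset.univ) => mul_mem (hlst a k.rev) (hfst b.rev k)
      convert this using 1
      refine Prod.ext ?_ ?_
      · rw [Prod.fst_sum]; exact h₁
      · rw [Prod.snd_sum]; exact h₂
    · exact hlst a k
  have hconst : ∀ c : 𝒪, (MvPolynomial.C c, algebraMap 𝒪 (ChartRing m l π) c) ∈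
      intertwiners σ := fun c => (intertwiners σ).algebraMap_mem c
  have hall : ∀ i j, (y i j, x i j) ∈ intertwiners σ := by
    rintro (a | a | a) j
    · have h₁ : y (fstIdx m l a) j = -MvPolynomial.C h *
          ∑ b, y (midIdx m l b) (lstIdx m l a.rev) * y (midIdx m l b.rev) j := by
        rw [hy]
        exact rankOne_fst_eq a j
      have h₂ := hhx _ _ (hN.two_mul_fst j a)
      have := mul_mem (hconst (-h)) (sum_mem fun b (_ : b ∈ Finset.univ) =>
        mul_mem (hmid b (lstIdx m l a.rev)) (hmid b.rev j))
      convert this using 1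
      refine Prod.ext ?_ ?_
      · rw [Prod.fst_mul, Prod.fst_sum, map_neg]; exact h₁
      · rw [Prod.snd_mul, Prod.snd_sum]; exact h₂
    · exact hmid a j
    · have h₁ : y (lstIdx m l a) j = -MvPolynomial.C h *
          ∑ b, y (midIdx m l b) (fstIdx m l a.rev) * y (midIdx m l b.rev) j := by
        rw [hy]
        exact rankOne_lst_eq a j
      have h₂ := hhx _ _ (hN.two_mul_lst j a)
      have := mul_mem (hconst (-h)) (sum_mem fun b (_ : b ∈ Finset.univ) =>
        mul_mem (hmid b (fstIdx m l a.rev)) (hmid b.rev j))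
      convert this using 1
      refine Prod.ext ?_ ?_
      · rw [Prod.fst_mul, Prod.fst_sum, map_neg]; exact h₁
      · rw [Prod.snd_mul, Prod.snd_sum]; exact h₂
  have hσ : ∀ e g, σ (rankOneHom m l h e * g) = mk e * σ g := by
    intro e
    have : ((rankOneHom m l h).prod mk) e ∈ intertwiners σ := by
      induction e using MvPolynomial.induction_on with
      | C c =>
        have := ((rankOneHom m l h).prod mk).commutes c
        rw [MvPolynomial.algebraMap_eq] at this
        rw [this]
        exact (intertwiners σ).algebraMap_mem c
      | add p q hp hq => rw [map_add]; exact add_mem hp hq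
      | mul_X p i hp => rw [map_mul]; exact mul_mem hp (hall i.1 i.2)
    exact this
  obtain ⟨g, hg⟩ := Ideal.mem_span_singleton'.1 hf
  have hquartic : quartic m l π = rankOneHom m l h ((blockA 𝒪 m l).trace +
      2 * MvPolynomial.C π) := by
    rw [map_add, map_mul, map_ofNat, AddMonoidHom.map_trace]
    have h₁ : (blockA 𝒪 m l).map (rankOneHom m l h) = y.submatrix (midIdx m l) (midIdx m l) := rfl
    rw [h₁, hy, rankOne_trace_mid, quartic]
    simp [rankOneHom]
  have hzero : mk ((blockA 𝒪 m l).trace + 2 * MvPolynomial.C π) = 0 := by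
    refine Ideal.Quotient.eq_zero_iff_mem.2 ((le_sup_right :
      addIdeal m l π ≤ naiveIdeal m l π ⊔ addIdeal m l π) (Ideal.subset_span ?_))
    exact Or.inl (Or.inl (Or.inr rfl))
  -- Evaluating `σ` on `φ(f) = g q` in two ways gives `f` and `0`.
  have h₁ := hσ f 1
  rw [mul_one, segreRetraction_one, mul_one, ← hg, mul_comm, hquartic, hσ, hzero, zero_mul] at h₁
  exact Ideal.Quotient.eq_zero_iff_mem.1 h₁.symm

theorem not_C_dvd_quartic [IsDomain 𝒪] (h2 : IsUnit (2 : 𝒪)) {π : 𝒪} (hπ : ¬IsUnit π)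
    (hl : 1 < l) (hm : 0 < m) : ¬MvPolynomial.C π ∣ quartic m l π := by
  rintro ⟨g, hg⟩
  have : NeZero l := ⟨by omega⟩
  have : NeZero m := ⟨by omega⟩
  -- At this point `s = 2` and `t = 1`, so `q` takes the value `2 + 2π`, and `π ∣ q` would make `π`
  -- divide the unit `2`. The value of `s` needs `0 ≠ Fin.rev 0`, hence `1 < l`.
  let x : Fin l ⊕ (Fin m ⊕ Fin m) → 𝒪 := Sum.elim
    (fun a => (if a = 0 then 1 else 0) + (if a = Fin.rev 0 then 1 else 0))
    (Sum.elim (fun k => if k = 0 then 1 else 0) (fun k => if k = Fin.rev 0 then 1 else 0))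
  have hne : (0 : Fin l) ≠ Fin.rev 0 := by
    simp [Fin.ext_iff, Fin.val_rev]; omega
  have h := congrArg (MvPolynomial.eval x) hg
  have hs : ∑ b : Fin l, x (Sum.inl b) * x (Sum.inl b.rev) = 2 := by
    have : ∀ b : Fin l, x (Sum.inl b) * x (Sum.inl b.rev) =
        (if b = 0 then 1 else 0) + (if b = Fin.rev 0 then 1 else 0) := fun b => by
      simp only [x, Sum.elim_inl, Fin.rev_eq_iff, Fin.rev_rev]
      by_cases h₀ : b = 0
      · subst h₀; simp [hne]
      · by_cases h₁ : b = Fin.rev 0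
        · subst h₁; simp [hne.symm]
        · simp [h₀, h₁]
    rw [Finset.sum_congr rfl fun b _ => this b, Finset.sum_add_distrib]
    simp [one_add_one_eq_two]
  have ht : ∑ k : Fin m, x (Sum.inr (Sum.inr k.rev)) * x (Sum.inr (Sum.inl k)) = 1 := by
    simp [x]
  simp only [quartic, map_add, map_mul, map_sum, MvPolynomial.eval_X, MvPolynomial.eval_C,
    map_ofNat] at h
  rw [hs, ht] at h
  refine hπ (isUnit_of_dvd_unit ⟨MvPolynomial.eval x g - 2, ?_⟩ h2)
  linear_combination h

/-- If `π φ(f) = g q` in `P`, the prime `π` divides `g` because it does not divide `q`; cancelling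
it gives `φ(f) ∈ (q)`, that is `f ∈ I`. -/
theorem algebraMap_mem_nonZeroDivisors [IsDomain 𝒪] (h2 : IsUnit (2 : 𝒪)) {π : 𝒪} (hπ : Prime π)
    (hl : 1 < l) (hm : 0 < m) :
    algebraMap 𝒪 (ChartRing m l π) π ∈ nonZeroDivisors (ChartRing m l π) := by
  obtain ⟨h, hh⟩ := h2.exists_right_inv
  rw [mem_nonZeroDivisors_iff_right]
  intro y hy
  obtain ⟨f, rfl⟩ := Ideal.Quotient.mk_surjective y
  have hf : f * MvPolynomial.C π ∈ chartIdeal m l π := by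
    rw [← Ideal.Quotient.eq_zero_iff_mem, map_mul]
    exact hy
  rw [Ideal.Quotient.eq_zero_iff_mem]
  refine mem_chartIdeal_of_rankOneHom_mem hh ?_
  obtain ⟨g, hg⟩ := Ideal.mem_span_singleton'.1 (rankOneHom_mem_span_quartic hh hf)
  have hC : rankOneHom m l h (MvPolynomial.C π) = MvPolynomial.C π := by simp [rankOneHom]
  rw [map_mul, hC] at hg
  have hprime : Prime (MvPolynomial.C π : MvPolynomial (Fin l ⊕ (Fin m ⊕ Fin m)) 𝒪) :=
    (MvPolynomial.prime_C_iff _).2 hπ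
  obtain ⟨g', rfl⟩ := (hprime.dvd_or_dvd ⟨_, hg.trans (mul_comm _ _)⟩).resolve_right
    (not_C_dvd_quartic h2 hπ.not_isUnit hl hm)
  refine Ideal.mem_span_singleton'.2 ⟨g', mul_left_cancel₀ hprime.ne_zero ?_⟩
  linear_combination hg

end Parametrization

/-- Over a discrete valuation ring, a module on which a uniformizer is injective is flat. -/
theorem flat_of_uniformizer_injective {𝒪 M : Type*} [CommRing 𝒪] [IsDomain 𝒪]
    [IsDiscreteValuationRing 𝒪] [AddCommGroup M] [Module 𝒪 M] {π : 𝒪} (hπ : Irreducible π)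
    (h : ∀ x : M, π • x = 0 → x = 0) : Module.Flat 𝒪 M := by
  rw [IsDedekindDomain.flat_iff_torsion_eq_bot, eq_bot_iff]
  rintro x ⟨⟨c, hc⟩, hx⟩
  obtain ⟨N, u, hu⟩ := IsDiscreteValuationRing.eq_unit_mul_pow_irreducible
    (nonZeroDivisors.ne_zero hc) hπ
  have hx' : (u : 𝒪) • π ^ N • x = 0 := by
    rw [smul_smul, ← hu]
    exact hx
  have hx₁ : π ^ N • x = 0 := by
    rw [← one_smul 𝒪 (π ^ N • x), ← u.inv_mul, mul_smul, hx', smul_zero]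
  clear hx hx' hu
  induction N with
  | zero => simpa using hx₁
  | succ N ih => exact ih (h _ (by rw [smul_smul, ← pow_succ', hx₁]))

end OrthogonalChart

open OrthogonalChart in
theorem theorem5p4 {𝒪 : Type*} [CommRing 𝒪] [IsDomain 𝒪] [IsDiscreteValuationRing 𝒪]
    (h2 : IsUnit (2 : 𝒪)) (π : 𝒪) (hπ : Irreducible π)
    (d l n r : ℕ) (hdn : d = 2 * n) (hlr : l = 2 * r)
    (hd : 5 ≤ d) (hl : 1 < l) (hl' : l + 1 < d) :
    AlgebraicGeometry.Flat (chartStructure (n - r) l π) ∧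
    algebraMap 𝒪 (ChartRing (n - r) l π) π ∈ nonZeroDivisors (ChartRing (n - r) l π) ∧
    chartIdeal (n - r) l π =
      ⨅ p : Idx (n - r) l × Idx (n - r) l,
        closureIdeal (naiveIdeal (n - r) l π) (MvPolynomial.C π * MvPolynomial.X p) := by
  -- The bound `l + 1 < d` forces `r < n`, so the natural subtraction `n - r` is genuine and
  -- positive.
  have hnzd := algebraMap_mem_nonZeroDivisors (m := n - r) h2 hπ.prime hl (by omega)
  refine ⟨?_, hnzd, chartIdeal_eq_iInf_closureIdeal π h2 hnzd⟩
  refine AlgebraicGeometry.Flat.SpecMap_iff.2 ?_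
  rw [CommRingCat.hom_ofHom, RingHom.flat_algebraMap_iff]
  refine flat_of_uniformizer_injective hπ fun x hx => ?_
  rw [Algebra.smul_def] at hx
  exact (mul_left_mem_nonZeroDivisors_eq_zero_iff hnzd).1 hx
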